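/- Consider the M/M/$c$/$K$ retrial queue with two types of nonpersistent customers ($1\le c\le K$). Primary customers arrive in a Poisson process of rate $\lambda>0$. With $i$ customers in the system (servers and waiting room, capacity $K$) the total service rate is $\nu_i$, where $0=\nu_0\le\nu_1\le\dots\le\nu_K$. A primary customer who finds the system full joins the orbit with probability $p$ and is lost with probability $1-p$. Each customer stays in the orbit for an exponential time of rate $\mu>0$ and then retries with probability $r$ or is lost with probability $\bar r=1-r$; a retrying customer enters the system if it is not full, and otherwise rejoins the orbit with probability $q$ or is lost with probability $\bar q=1-q$ ($p,q,r\in[0,1]$). Let $C(t)$ and $N(t)$ be the numbers of customers in the system and in the orbit at time $t$, so that $(C(t),N(t))$ is a continuous-time Markov chain on $\{0,\dots,K\}\times\mathbb Z_+$; assume that it is ergodic and let $$\pi_{i,n}=\lim_{t\to\infty}\Pr\{C(t)=i,\,N(t)=n\}$$ be its limiting (stationary) probability distribution. Suppose that $\bar r+r\bar q>0$, and put $\gamma^{(0)}_1=\dfrac{\lambda p}{\mu(\bar r+r\bar q)}$. Then there are constants $C_1,C_2>0$, independent of $n$, such that for all integers $n\ge1$ $$C_1\,\frac{1}{n!}\,(\gamma^{(0)}_1)^n\,n^{-\frac{\nu_K}{\mu(\bar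 r+r\bar q)}}\;\le\;\pi_{K,n}\;\le\;C_2\,\frac{1}{n!}\,(\gamma^{(0)}_1)^n\,n^{-\frac{\nu_K}{\mu(\bar r+r\bar q)}}.$$ -/

import Mathlib

open Set Filter Topology MeasureTheory

noncomputable section

/-- States `(i, n)`: `i` customers in the system (servers and waiting room), `n` in the orbit. -/
abbrev QueueState (K : ℕ) : Type := Fin (K + 1) × ℕ

/-- Parameters of the M/M/c/K retrial queue with two types of nonpersistent customers. -/
structure RetrialQueue (K : ℕ) where
  /-- capacity of the system: at least one server -/
  one_le_K : 1 ≤ K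
  /-- arrival rate of primary customers -/
  lam : ℝ
  lam_pos : 0 < lam
  /-- rate at which each customer in the orbit leaves it -/
  mu : ℝ
  mu_pos : 0 < mu
  /-- probability that a blocked primary customer joins the orbit -/
  p : ℝ
  p_nonneg : 0 ≤ p
  p_le_one : p ≤ 1
  /-- probability that a blocked retrial customer rejoins the orbit -/
  q : ℝ
  q_nonneg : 0 ≤ q
  q_le_one : q ≤ 1
  /-- probability that a customer leaving the orbit retries -/
  r : ℝ
  r_nonneg : 0 ≤ r
  r_le_one : r ≤ 1
  /-- total service rate when there are `i` customers in the system -/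
  nu : Fin (K + 1) → ℝ
  nu_zero : nu 0 = 0
  nu_mono : Monotone nu

namespace RetrialQueue

variable {K : ℕ}

/-- `r̄ + r q̄`: the probability that a customer who leaves the orbit while the system is full
is lost. -/
def delta (M : RetrialQueue K) : ℝ := (1 - M.r) + M.r * (1 - M.q)

/-- `γ₁⁽⁰⁾ = λ p / (μ (r̄ + r q̄))`. -/
def gamma (M : RetrialQueue K) : ℝ := M.lam * M.p / (M.mu * M.delta)

/-- Block of rates from level `n` to level `n + 1`. -/
def Q0 (M : RetrialQueue K) : Matrix (Fin (K + 1)) (Fin (K + 1)) ℝ := fun i j =>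
  if i = Fin.last K ∧ j = Fin.last K then M.lam * M.p else 0

/-- Block of rates inside level `n`, with the diagonal of the generator. -/
def Q1 (M : RetrialQueue K) (n : ℕ) : Matrix (Fin (K + 1)) (Fin (K + 1)) ℝ := fun i j =>
  if i = j then
    if i = Fin.last K then -(M.lam * M.p + n * M.mu * M.delta + M.nu i)
    else -(M.lam + n * M.mu + M.nu i)
  else if (j : ℕ) = i + 1 then M.lam
  else if (i : ℕ) = j + 1 then M.nu i
  else 0

/-- Block of rates from level `n` to level `n - 1`. -/
def Q2 (M : RetrialQueue K) (n : ℕ) : Matrix (Fin (K + 1)) (Fin (K + 1)) ℝ := fun i j =>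
  if i = j then
    if i = Fin.last K then n * M.mu * M.delta
    else n * M.mu * (1 - M.r)
  else if (j : ℕ) = i + 1 then n * M.mu * M.r
  else 0

/-- The infinitesimal generator of `(C(t), N(t))`, a level-dependent quasi-birth-death generator:
`M.generator x y` is the rate from `x` to `y` for `x ≠ y`. -/
def generator (M : RetrialQueue K) (x y : QueueState K) : ℝ :=
  if y.2 = x.2 + 1 then M.Q0 x.1 y.1
  else if y.2 = x.2 then M.Q1 x.2 x.1 y.1
  else if x.2 = y.2 + 1 then M.Q2 x.2 x.1 y.1
  else 0

end RetrialQueue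

/-- `P t x y` (`t ≥ 0`) is an honest transition function on `S` with generator `Q`: a semigroup of
stochastic matrices, starting at the identity, that solves Kolmogorov's forward equation
`P' = P Q`. (Each column of the queue generator above has finitely many nonzero entries, so the sum
in the forward equation is a finite sum there.) -/
structure IsTransitionFunction {S : Type*} [DecidableEq S] (Q : S → S → ℝ)
    (P : ℝ → S → S → ℝ) : Prop where
  nonneg : ∀ t, 0 ≤ t → ∀ x y, 0 ≤ P t x y
  hasSum_one : ∀ t, 0 ≤ t → ∀ x, HasSum (fun y => P t x y) 1
  zero : ∀ x y, P 0 x y = if x = y then 1 else 0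
  chapman_kolmogorov : ∀ s t, 0 ≤ s → 0 ≤ t → ∀ x y,
    HasSum (fun z => P s x z * P t z y) (P (s + t) x y)
  forward : ∀ t, 0 ≤ t → ∀ x y,
    HasDerivWithinAt (fun s => P s x y) (∑' z, P t x z * Q z y) (Ici 0) t

/-- `X` is a time-homogeneous continuous-time Markov chain (any initial law) with generator `Q`:
its finite-dimensional distributions are given by a transition function with generator `Q`. -/
def IsMarkovChain {S : Type*} [DecidableEq S] [MeasurableSpace S] {Ω : Type*} [MeasurableSpace Ω]
    (Q : S → S → ℝ) (μ : Measure Ω) (X : ℝ → Ω → S) : Prop :=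
  (∀ t, 0 ≤ t → Measurable (X t)) ∧
  ∃ P : ℝ → S → S → ℝ, IsTransitionFunction Q P ∧
    ∀ (m : ℕ) (t : Fin (m + 1) → ℝ) (x : Fin (m + 1) → S), 0 ≤ t 0 → Monotone t →
      μ.real {ω | ∀ i, X (t i) ω = x i} =
        μ.real {ω | X (t 0) ω = x 0} *
          ∏ i : Fin m, P (t i.succ - t i.castSucc) (x i.castSucc) (x i.succ)

/-- `π` is the limiting distribution of the process `X`: `π x = lim_{t → ∞} Pr {X(t) = x}` for every
state, and the limits form a probability distribution (ergodicity). -/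
def IsLimitingDistribution {S : Type*} {Ω : Type*} [MeasurableSpace Ω]
    (μ : Measure Ω) (X : ℝ → Ω → S) (π : S → ℝ) : Prop :=
  (∀ x, Tendsto (fun t => μ.real {ω | X t ω = x}) atTop (𝓝 (π x))) ∧ HasSum π 1

end

/-! Write `x n` for the limiting mass of the full state with `n` in orbit, `S n` for the mass of the
other states on level `n`, and δ = r̄ + r q̄. The limits satisfy the balance equations
(`IsMarkovChain.balance`). Adding these over whole levels gives λp x(n) = (n+1)μ (S(n+1) + δ x(n+1))
(`cut`). Hence y(n) = x(n) n!/γⁿ satisfies y(n) = y(n+1)(1 + u(n+1)) with u(n) = S(n)/(δ x(n)).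

Balance at the full states first gives the crude bound S(n) = O(x(n)/n) (`unblocked_le`). Fed back
into the same equation, it sharpens to nμ S(n) = ν_K x(n) + O(x(n)/n) (`exists_unblocked_bound`). So
u(n) = κ/n + O(1/n²) with κ = ν_K/(μδ), and the product of the factors 1 + u(k) over k ≤ n has order
n^κ (`exists_rpow_bounds_of_ratio`). -/

/-! ### Balance equations for the limiting distribution. -/

theorem eq_zero_of_tendsto_of_tendsto_deriv {f f' : ℝ → ℝ} {c l : ℝ}
    (hf : Tendsto f atTop (𝓝 c)) (hf' : Tendsto f' atTop (𝓝 l))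
    (h : ∀ t, 0 < t → HasDerivAt f (f' t) t) : l = 0 := by
  -- Mean value theorem on [n+1, n+2]; the shift by 1 keeps the interval inside t > 0.
  have key : ∀ n : ℕ, ∃ t : ℝ, (n : ℝ) + 1 < t ∧ f' t = f ((n : ℝ) + 1 + 1) - f ((n : ℝ) + 1) := by
    intro n
    have hn : (0 : ℝ) ≤ n := n.cast_nonneg
    obtain ⟨t, ht, e⟩ := exists_hasDerivAt_eq_slope f f' (lt_add_one ((n : ℝ) + 1))
      (fun t ht => (h t (by linarith [ht.1])).continuousAt.continuousWithinAt)
      (fun t ht => h t (by linarith [ht.1]))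
    refine ⟨t, ht.1, ?_⟩
    rw [e]; simp
  choose t ht e using key
  have hn : Tendsto (fun n : ℕ => (n : ℝ) + 1) atTop atTop :=
    tendsto_atTop_add_const_right _ _ tendsto_natCast_atTop_atTop
  have ht' : Tendsto t atTop atTop := tendsto_atTop_mono (fun n => (ht n).le) hn
  have h1 := hf'.comp ht'
  have h2 := (hf.comp (tendsto_atTop_add_const_right _ 1 hn)).sub (hf.comp hn)
  rw [sub_self] at h2
  refine tendsto_nhds_unique h1 (h2.congr fun n => ?_)
  simp [e]

namespace IsTransitionFunction

variable {S : Type*} [DecidableEq S] {Q : S → S → ℝ} {P : ℝ → S → S → ℝ}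

theorem le_one (h : IsTransitionFunction Q P) {t : ℝ} (ht : 0 ≤ t) (x y : S) : P t x y ≤ 1 :=
  le_hasSum (h.hasSum_one t ht x) y fun z _ => h.nonneg t ht x z

end IsTransitionFunction

theorem tsum_eq_sum_column {S : Type*} {Q : S → S → ℝ} {y : S} {s : Finset S}
    (hs : ∀ z, z ∉ s → Q z y = 0) (v : S → ℝ) :
    ∑' z, v z * Q z y = ∑ z ∈ s, v z * Q z y :=
  tsum_eq_sum fun z hz => by rw [hs z hz, mul_zero]

theorem hasSum_measureReal_eq_and {S Ω : Type*} [Countable S] [MeasurableSpace S]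
    [MeasurableSingletonClass S] [MeasurableSpace Ω] {μ : Measure Ω} [IsFiniteMeasure μ]
    {Y Z : Ω → S} (hY : Measurable Y) (hZ : Measurable Z) (y : S) :
    HasSum (fun x => μ.real {ω | Y ω = x ∧ Z ω = y}) (μ.real {ω | Z ω = y}) := by
  have hm : ∀ x, MeasurableSet {ω | Y ω = x ∧ Z ω = y} := fun x =>
    (hY (measurableSet_singleton x)).inter (hZ (measurableSet_singleton y))
  have hd : Pairwise (Function.onFun Disjoint fun x => {ω | Y ω = x ∧ Z ω = y}) := by
    intro a b hab
    refine Set.disjoint_left.2 fun ω h1 h2 => hab (h1.1.symm.trans h2.1)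
  have hU : (⋃ x, {ω | Y ω = x ∧ Z ω = y}) = {ω | Z ω = y} := by
    ext ω; simp
  rw [← hU]
  simp only [measureReal_def]
  rw [measure_iUnion hd hm, ENNReal.tsum_toReal_eq fun x => measure_ne_top μ _]
  refine ENNReal.hasSum_toReal ?_
  rw [← measure_iUnion hd hm]
  exact measure_ne_top μ _

/-- Total probability over the initial state, from the two-time law at 0 and `t`. -/
theorem hasSum_law_mul_transition {S Ω : Type*} [Countable S] [MeasurableSpace S]
    [MeasurableSingletonClass S] [MeasurableSpace Ω] {μ : Measure Ω} [IsFiniteMeasure μ]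
    {X : ℝ → Ω → S} {P : ℝ → S → S → ℝ} (hX : ∀ t, 0 ≤ t → Measurable (X t))
    (hP : ∀ (m : ℕ) (t : Fin (m + 1) → ℝ) (x : Fin (m + 1) → S), 0 ≤ t 0 → Monotone t →
      μ.real {ω | ∀ i, X (t i) ω = x i} =
        μ.real {ω | X (t 0) ω = x 0} *
          ∏ i : Fin m, P (t i.succ - t i.castSucc) (x i.castSucc) (x i.succ))
    {t : ℝ} (ht : 0 ≤ t) (y : S) :
    HasSum (fun x => μ.real {ω | X 0 ω = x} * P t x y) (μ.real {ω | X t ω = y}) := by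
  have h := hasSum_measureReal_eq_and (μ := μ) (hX 0 le_rfl) (hX t ht) y
  convert h using 2 with x
  have h1 := hP 1 ![0, t] ![x, y] (by simp) (by
    rw [Fin.monotone_iff_le_succ]; intro i; fin_cases i; simpa using ht)
  simpa [Fin.forall_fin_two] using h1.symm

namespace IsMarkovChain

variable {S : Type*} [DecidableEq S] [Countable S] [MeasurableSpace S] [MeasurableSingletonClass S]
  {Ω : Type*} [MeasurableSpace Ω] {Q : S → S → ℝ} {μ : Measure Ω} [IsProbabilityMeasure μ]
  {X : ℝ → Ω → S}

/-- The limiting distribution of a Markov chain whose generator has finitely supported columns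
satisfies the balance equations. -/
theorem balance (hX : IsMarkovChain Q μ X) {π : S → ℝ} (hπ : IsLimitingDistribution μ X π)
    {y : S} {s : Finset S} (hs : ∀ z, z ∉ s → Q z y = 0) : ∑ z ∈ s, π z * Q z y = 0 := by
  obtain ⟨hm, P, hT, hP⟩ := hX
  refine eq_zero_of_tendsto_of_tendsto_deriv (hπ.1 y)
    (f' := fun t => ∑ z ∈ s, μ.real {ω | X t ω = z} * Q z y)
    (tendsto_finsetSum _ fun z _ => (hπ.1 z).mul_const _) fun t ht => ?_
  have h0 : Summable fun x => μ.real {ω | X 0 ω = x} := by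
    simpa using (hasSum_measureReal_eq_and (μ := μ) (hm 0 le_rfl)
      (measurable_const (a := y)) y).summable
  -- Termwise differentiation is dominated uniformly in time: transition probabilities are at most
  -- 1, so each term is at most the initial mass times the absolute sum of column `y`.
  have hd : HasDerivAt (fun t => ∑' x, μ.real {ω | X 0 ω = x} * P t x y)
      (∑' x, μ.real {ω | X 0 ω = x} * ∑ z ∈ s, P t x z * Q z y) t := by
    refine hasDerivAt_tsum_of_isPreconnected
      (g := fun x t => μ.real {ω | X 0 ω = x} * P t x y)
      (g' := fun x t => μ.real {ω | X 0 ω = x} * ∑ z ∈ s, P t x z * Q z y)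
      (h0.mul_right (∑ z ∈ s, ‖Q z y‖))
      isOpen_Ioi isPreconnected_Ioi (fun x u hu => ?_) (fun x u hu => ?_) ht
      (hasSum_law_mul_transition hm hP ht.le y).summable ht
    · have := (hT.forward u (le_of_lt hu) x y).hasDerivAt (Ici_mem_nhds hu)
      rw [tsum_eq_sum_column hs] at this
      exact this.const_mul _
    · rw [norm_mul, Real.norm_of_nonneg measureReal_nonneg]
      refine mul_le_mul_of_nonneg_left ?_ measureReal_nonneg
      refine (norm_sum_le _ _).trans (Finset.sum_le_sum fun z _ => ?_)
      rw [norm_mul, Real.norm_of_nonneg (hT.nonneg u (le_of_lt hu) x z)]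
      exact mul_le_of_le_one_left (norm_nonneg _) (hT.le_one (le_of_lt hu) x z)
  have he : (∑' x, μ.real {ω | X 0 ω = x} * ∑ z ∈ s, P t x z * Q z y)
      = ∑ z ∈ s, μ.real {ω | X t ω = z} * Q z y := by
    have : HasSum (fun x => ∑ z ∈ s, μ.real {ω | X 0 ω = x} * P t x z * Q z y)
        (∑ z ∈ s, μ.real {ω | X t ω = z} * Q z y) :=
      hasSum_sum fun z _ => (hasSum_law_mul_transition hm hP ht.le z).mul_right _
    rw [← this.tsum_eq]
    simp only [Finset.mul_sum, mul_assoc]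
  rw [he] at hd
  refine hd.congr_of_eventuallyEq ?_
  filter_upwards [Ioi_mem_nhds ht] with u hu
  exact (hasSum_law_mul_transition hm hP (le_of_lt hu) y).tsum_eq.symm

end IsMarkovChain

/-! ### Power-law order from consecutive ratios. -/

namespace Real

theorem abs_log_one_add_sub_le {u : ℝ} (hu : 0 ≤ u) : |log (1 + u) - u| ≤ u ^ 2 := by
  have h1 : log (1 + u) ≤ u := by linarith [log_le_sub_one_of_pos (by linarith : 0 < 1 + u)]
  have h2 := one_sub_inv_le_log_of_pos (by linarith : 0 < 1 + u)
  have h3 : u - u ^ 2 ≤ 1 - (1 + u)⁻¹ := by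
    have e : 1 - (1 + u)⁻¹ - (u - u ^ 2) = u ^ 3 / (1 + u) := by field_simp; ring
    have : 0 ≤ u ^ 3 / (1 + u) := by positivity
    linarith
  rw [abs_le]; constructor <;> linarith [sq_nonneg u]

/-- The increment of log lies between 1/(x+1) and 1/x; this form of the error telescopes along the
integers. -/
theorem abs_log_sub_log_sub_inv_le {x : ℝ} (hx : 0 < x) :
    |log (x + 1) - log x - 1 / (x + 1)| ≤ 1 / x - 1 / (x + 1) := by
  have h1 := log_le_sub_one_of_pos (by positivity : 0 < (x + 1) / x)
  have h2 := one_sub_inv_le_log_of_pos (by positivity : 0 < (x + 1) / x)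
  rw [log_div (by positivity) hx.ne'] at h1 h2
  have e1 : (x + 1) / x - 1 = 1 / x := by field_simp; ring
  have e2 : 1 - ((x + 1) / x)⁻¹ = 1 / (x + 1) := by field_simp; ring
  have h4 : 1 / (x + 1) ≤ 1 / x := by gcongr; linarith
  rw [abs_le]; constructor <;> linarith

end Real

/-- If `y n = y (n + 1) * (1 + u)` with `u = κ / (n + 1) + O((n + 1)⁻²)`, then `y n` is of the
order of `n ^ (-κ)`. -/
theorem exists_rpow_bounds_of_ratio {y u : ℕ → ℝ} {κ B : ℝ} (hκ : 0 ≤ κ) (hy : ∀ n, 0 < y n)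
    (hu : ∀ n, 1 ≤ n → 0 ≤ u n) (huB : ∀ n : ℕ, 1 ≤ n → |u n - κ / n| ≤ B / n ^ 2)
    (h : ∀ n, y n = y (n + 1) * (1 + u (n + 1))) :
    ∃ C₁ C₂ : ℝ, 0 < C₁ ∧ 0 < C₂ ∧ ∀ n : ℕ, 1 ≤ n →
      C₁ * (n : ℝ) ^ (-κ) ≤ y n ∧ y n ≤ C₂ * (n : ℝ) ^ (-κ) := by
  have hB : 0 ≤ B := by simpa using (abs_nonneg _).trans (huB 1 le_rfl)
  set z : ℕ → ℝ := fun n => Real.log (y n) + κ * Real.log n with hz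
  -- One summand per error: log(1+u) against u, u against κ/(n+1), and 1/(n+1) against the increment
  -- of log.
  set D : ℝ := (κ + B) ^ 2 + B + κ with hD
  have step : ∀ n : ℕ, 1 ≤ n → |z (n + 1) - z n| ≤ D * (1 / n - 1 / (n + 1)) := by
    intro n hn
    have hn0 : (0 : ℝ) < n := by exact_mod_cast hn
    have hn1 : (1 : ℝ) ≤ (n : ℝ) + 1 := by linarith
    have hun := hu (n + 1) (by omega)
    have hB' := huB (n + 1) (by omega)
    push_cast at hB'
    have e : z (n + 1) - z n = -(Real.log (1 + u (n + 1)) - u (n + 1))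
        - (u (n + 1) - κ / ((n : ℝ) + 1))
        + κ * (Real.log ((n : ℝ) + 1) - Real.log n - 1 / ((n : ℝ) + 1)) := by
      simp only [hz]
      rw [h n, Real.log_mul (hy _).ne' (by positivity)]
      push_cast; ring
    have h1 := Real.abs_log_one_add_sub_le hun
    have h2 := Real.abs_log_sub_log_sub_inv_le hn0
    have hub : u (n + 1) ≤ (κ + B) / ((n : ℝ) + 1) := by
      have h3 : B / ((n : ℝ) + 1) ^ 2 ≤ B / ((n : ℝ) + 1) := by
        gcongr; nlinarith
      have := (abs_le.1 hB').2
      rw [add_div]; linarith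
    have hsq : 1 / ((n : ℝ) + 1) ^ 2 ≤ 1 / n - 1 / (n + 1) := by
      rw [div_sub_div _ _ hn0.ne' (by positivity), div_le_div_iff₀ (by positivity) (by positivity)]
      nlinarith
    have h5 : u (n + 1) ^ 2 ≤ (κ + B) ^ 2 * (1 / n - 1 / (n + 1)) := by
      calc u (n + 1) ^ 2 ≤ ((κ + B) / ((n : ℝ) + 1)) ^ 2 := by gcongr
        _ = (κ + B) ^ 2 * (1 / ((n : ℝ) + 1) ^ 2) := by rw [div_pow]; ring
        _ ≤ _ := by gcongr
    have h6 : B / ((n : ℝ) + 1) ^ 2 ≤ B * (1 / n - 1 / (n + 1)) := by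
      rw [div_eq_mul_one_div]; gcongr
    have h7 : |κ * (Real.log ((n : ℝ) + 1) - Real.log n - 1 / ((n : ℝ) + 1))|
        ≤ κ * (1 / n - 1 / (n + 1)) := by
      rw [abs_mul, abs_of_nonneg hκ]; gcongr
    rw [e, hD, add_mul, add_mul]
    refine (abs_add_le _ _).trans (add_le_add ((abs_sub _ _).trans (add_le_add ?_ ?_)) h7)
    · rw [abs_neg]; exact h1.trans h5
    · exact hB'.trans h6
  have bound : ∀ n : ℕ, 1 ≤ n → |z n - z 1| ≤ D * (1 - 1 / n) := by
    intro n hn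
    induction n, hn using Nat.le_induction with
    | base => simp
    | succ n hn ih =>
      have := step n hn
      have h3 := abs_add_le (z (n + 1) - z n) (z n - z 1)
      rw [sub_add_sub_cancel] at h3
      push_cast
      linarith
  have hD0 : 0 ≤ D := by positivity
  refine ⟨Real.exp (z 1 - D), Real.exp (z 1 + D), Real.exp_pos _, Real.exp_pos _, fun n hn => ?_⟩
  have hn0 : (0 : ℝ) < n := by exact_mod_cast hn
  have hb : |z n - z 1| ≤ D := (bound n hn).trans (by
    have : (0 : ℝ) ≤ 1 / n := by positivity
    nlinarith)
  have hyz : y n = Real.exp (z n) * (n : ℝ) ^ (-κ) := by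
    rw [Real.rpow_def_of_pos hn0, ← Real.exp_add, hz]
    simp only
    rw [show Real.log (y n) + κ * Real.log n + Real.log n * -κ = Real.log (y n) by ring,
      Real.exp_log (hy n)]
  have := abs_le.1 hb
  rw [hyz]
  constructor <;> gcongr <;> linarith

/-! ### Row sums and last columns of the generator blocks. -/

namespace RetrialQueue

variable {K : ℕ} (M : RetrialQueue K)

theorem nu_nonneg (i : Fin (K + 1)) : 0 ≤ M.nu i := by
  rw [← M.nu_zero]; exact M.nu_mono (Fin.zero_le i)

theorem sum_Q0 (i : Fin (K + 1)) :
    ∑ j, M.Q0 i j = if i = Fin.last K then M.lam * M.p else 0 := by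
  by_cases hi : i = Fin.last K <;> simp [Q0, hi]

theorem sum_ite_val_eq_succ (i : Fin (K + 1)) (c : ℝ) :
    ∑ j : Fin (K + 1), (if (j : ℕ) = i + 1 then c else 0) = if i = Fin.last K then 0 else c := by
  split_ifs with hi
  · refine Finset.sum_eq_zero fun j _ => if_neg ?_
    have := j.2
    simp only [hi, Fin.val_last]; omega
  · have h : (i : ℕ) + 1 < K + 1 := by
      have := Fin.val_lt_last hi; omega
    rw [Finset.sum_eq_single (⟨i + 1, h⟩ : Fin (K + 1))]
    · simp
    · intro j _ hj
      exact if_neg fun e => hj (Fin.ext e)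
    · simp

theorem sum_ite_val_succ_eq (i : Fin (K + 1)) :
    ∑ j : Fin (K + 1), (if (i : ℕ) = j + 1 then M.nu i else 0) = M.nu i := by
  by_cases hi : i = 0
  · simp [hi, M.nu_zero]
  · have h0 : (i : ℕ) ≠ 0 := fun h => hi (Fin.ext h)
    have h : (i : ℕ) - 1 < K + 1 := by omega
    rw [Finset.sum_eq_single (⟨i - 1, h⟩ : Fin (K + 1))]
    · rw [if_pos]; simp only; omega
    · intro j _ hj
      exact if_neg fun e => hj (Fin.ext (by simp only; omega))
    · simp

theorem sum_Q1 (n : ℕ) (i : Fin (K + 1)) :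
    ∑ j, M.Q1 n i j =
      if i = Fin.last K then -(M.lam * M.p + n * M.mu * M.delta) else -(n * M.mu) := by
  have h : ∀ j, M.Q1 n i j = (if i = j then (if i = Fin.last K then
      -(M.lam * M.p + n * M.mu * M.delta + M.nu i) else -(M.lam + n * M.mu + M.nu i)) else 0)
      + (if (j : ℕ) = i + 1 then M.lam else 0) + (if (i : ℕ) = j + 1 then M.nu i else 0) := by
    intro j
    rw [Q1]
    by_cases h1 : i = j
    · subst h1; simp
    · by_cases h2 : (j : ℕ) = i + 1
      · have h3 : ¬ (i : ℕ) = j + 1 := by omega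
        simp only [h1, h2, if_true, if_false]
        simp
        omega
      · simp [h1, h2]
  simp only [h, Finset.sum_add_distrib, sum_ite_val_eq_succ, sum_ite_val_succ_eq]
  simp only [Finset.sum_ite_eq, Finset.mem_univ, if_true]
  split_ifs <;> ring

theorem sum_Q2 (n : ℕ) (i : Fin (K + 1)) :
    ∑ j, M.Q2 n i j = if i = Fin.last K then n * M.mu * M.delta else n * M.mu := by
  have h : ∀ j, M.Q2 n i j = (if i = j then (if i = Fin.last K then
      n * M.mu * M.delta else n * M.mu * (1 - M.r)) else 0)
      + (if (j : ℕ) = i + 1 then n * M.mu * M.r else 0) := by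
    intro j
    rw [Q2]
    by_cases h1 : i = j
    · subst h1; simp
    · simp [h1]
  simp only [h, Finset.sum_add_distrib, sum_ite_val_eq_succ]
  simp only [Finset.sum_ite_eq, Finset.mem_univ, if_true]
  split_ifs <;> ring

theorem generator_eq_zero {x y : QueueState K} (h : y.2 + 1 < x.2 ∨ x.2 + 1 < y.2) :
    M.generator x y = 0 := by
  rw [generator, if_neg (by omega), if_neg (by omega), if_neg (by omega)]

theorem generator_nonneg {x y : QueueState K} (h : x ≠ y) : 0 ≤ M.generator x y := by
  have h1 := M.lam_pos.le
  have h2 := M.mu_pos.le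
  have h3 := M.p_nonneg
  have h4 := M.r_nonneg
  have h5 : 0 ≤ 1 - M.r := by linarith [M.r_le_one]
  have h6 : 0 ≤ 1 - M.q := by linarith [M.q_le_one]
  have h7 := M.nu_nonneg
  have h8 : 0 ≤ M.delta := by rw [delta]; positivity
  obtain ⟨i, m⟩ := x
  obtain ⟨j, n⟩ := y
  have h9 := h7 i
  rw [generator]
  simp only
  split_ifs with e1 e2 e3
  · rw [Q0]; split_ifs <;> positivity
  · have : i ≠ j := fun e => h (by rw [e, e2])
    rw [Q1, if_neg this]; split_ifs <;> positivity
  · rw [Q2]; split_ifs <;> positivity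
  · exact le_rfl

/-- Nonnegative solutions of the balance equations. -/
structure IsStationary (v : QueueState K → ℝ) : Prop where
  nonneg : ∀ x, 0 ≤ v x
  balance : ∀ (y : QueueState K) (s : Finset (QueueState K)),
    (∀ z, z ∉ s → M.generator z y = 0) → ∑ z ∈ s, v z * M.generator z y = 0

/-- Mass of the states on level `n` in which the system is not full. -/
def unblocked (v : QueueState K → ℝ) (n : ℕ) : ℝ := ∑ i : Fin K, v (i.castSucc, n)

/-- Mass of the states on level `n` with exactly one free place. -/
def almostBlocked (v : QueueState K → ℝ) (n : ℕ) : ℝ :=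
  ∑ i : Fin K, if (i : ℕ) + 1 = K then v (i.castSucc, n) else 0

theorem sum_Q1_last (v : QueueState K → ℝ) (n : ℕ) :
    ∑ i, v (i, n) * M.Q1 n i (Fin.last K) = M.lam * almostBlocked v n
      - (M.lam * M.p + n * M.mu * M.delta + M.nu (Fin.last K)) * v (Fin.last K, n) := by
  rw [Fin.sum_univ_castSucc, almostBlocked, Finset.mul_sum]
  have : ∀ i : Fin K, v (i.castSucc, n) * M.Q1 n i.castSucc (Fin.last K)
      = M.lam * (if (i : ℕ) + 1 = K then v (i.castSucc, n) else 0) := by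
    intro i
    have h1 : ¬ (i : ℕ) = K + 1 := by omega
    simp only [Q1, Fin.castSucc_ne_last, if_false, Fin.val_last, Fin.val_castSucc, h1,
      eq_comm (a := K)]
    split_ifs <;> ring
  simp only [this]
  simp only [Q1, if_true]
  ring

theorem sum_Q2_last (v : QueueState K → ℝ) (n : ℕ) :
    ∑ i, v (i, n) * M.Q2 n i (Fin.last K) = n * M.mu * M.r * almostBlocked v n
      + n * M.mu * M.delta * v (Fin.last K, n) := by
  rw [Fin.sum_univ_castSucc, almostBlocked, Finset.mul_sum]
  have : ∀ i : Fin K, v (i.castSucc, n) * M.Q2 n i.castSucc (Fin.last K)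
      = n * M.mu * M.r * (if (i : ℕ) + 1 = K then v (i.castSucc, n) else 0) := by
    intro i
    simp only [Q2, Fin.castSucc_ne_last, if_false, Fin.val_last, Fin.val_castSucc,
      eq_comm (a := K)]
    split_ifs <;> ring
  simp only [this]
  simp only [Q2, if_true]
  ring

theorem sum_Q0_last (v : QueueState K → ℝ) (n : ℕ) :
    ∑ i, v (i, n) * M.Q0 i (Fin.last K) = M.lam * M.p * v (Fin.last K, n) := by
  simp [Q0, mul_comm]

end RetrialQueue

/-! ### Stationary flows and the order of the full-state masses. -/

namespace RetrialQueue

variable {K : ℕ} {M : RetrialQueue K} {v : QueueState K → ℝ}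

theorem sum_level (v : QueueState K → ℝ) (n : ℕ) (a b : ℝ) :
    ∑ i, v (i, n) * (if i = Fin.last K then a else b)
      = b * unblocked v n + a * v (Fin.last K, n) := by
  rw [Fin.sum_univ_castSucc, unblocked, Finset.mul_sum]
  simp [mul_comm]

theorem sum_sum_mul (w : Fin (K + 1) → ℝ) (A : Matrix (Fin (K + 1)) (Fin (K + 1)) ℝ) :
    ∑ j, ∑ i, w i * A i j = ∑ i, w i * ∑ j, A i j := by
  rw [Finset.sum_comm]; simp only [Finset.mul_sum]

theorem almostBlocked_nonneg (hv : ∀ x, 0 ≤ v x) (n : ℕ) : 0 ≤ almostBlocked v n :=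
  Finset.sum_nonneg fun i _ => by split_ifs; exacts [hv _, le_rfl]

theorem almostBlocked_le (hv : ∀ x, 0 ≤ v x) (n : ℕ) : almostBlocked v n ≤ unblocked v n :=
  Finset.sum_le_sum fun i _ => by split_ifs; exacts [le_rfl, hv _]

namespace IsStationary

theorem balance_zero (h : M.IsStationary v) (j : Fin (K + 1)) :
    ∑ i, v (i, 0) * M.Q1 0 i j + ∑ i, v (i, 1) * M.Q2 1 i j = 0 := by
  have := h.balance (j, 0) (Finset.univ ×ˢ {0, 1}) fun z hz =>
    M.generator_eq_zero (Or.inl (by simp at hz ⊢; omega))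
  rw [Finset.sum_product_right, Finset.sum_pair (by omega)] at this
  simpa [generator] using this

theorem balance_succ (h : M.IsStationary v) (n : ℕ) (j : Fin (K + 1)) :
    ∑ i, v (i, n) * M.Q0 i j + ∑ i, v (i, n + 1) * M.Q1 (n + 1) i j
      + ∑ i, v (i, n + 2) * M.Q2 (n + 2) i j = 0 := by
  have := h.balance (j, n + 1) (Finset.univ ×ˢ {n, n + 1, n + 2}) fun z hz =>
    M.generator_eq_zero (by simp at hz ⊢; omega)
  rw [Finset.sum_product_right, Finset.sum_insert (by simp), Finset.sum_pair (by omega),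
    ← add_assoc] at this
  simpa [generator] using this

/-- The flows between two consecutive levels of the orbit balance. -/
theorem cut (h : M.IsStationary v) (n : ℕ) :
    M.lam * M.p * v (Fin.last K, n) = ((n : ℝ) + 1) * M.mu *
      (unblocked v (n + 1) + M.delta * v (Fin.last K, n + 1)) := by
  induction n with
  | zero =>
    have := Finset.sum_eq_zero fun j (_ : j ∈ Finset.univ) => h.balance_zero j
    rw [Finset.sum_add_distrib, sum_sum_mul, sum_sum_mul] at this
    simp only [sum_Q1, sum_Q2, sum_level] at this
    push_cast at this ⊢
    linarith
  | succ n ih =>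
    -- Transitions inside the level cancel in the sum over `j`, leaving the difference of two
    -- consecutive cut equations.
    have := Finset.sum_eq_zero fun j (_ : j ∈ Finset.univ) => h.balance_succ n j
    rw [Finset.sum_add_distrib, Finset.sum_add_distrib, sum_sum_mul, sum_sum_mul,
      sum_sum_mul] at this
    simp only [sum_Q0, sum_Q1, sum_Q2, sum_level] at this
    push_cast at this ⊢
    linarith

/-- The flows between the full and the other states with at least one orbiting customer, with the
level cuts substituted. -/
theorem full_balance (h : M.IsStationary v) (n : ℕ) :
    ((n : ℝ) + 2) * M.mu * unblocked v (n + 2) + M.nu (Fin.last K) * v (Fin.last K, n + 1)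
      = M.lam * almostBlocked v (n + 1) + ((n : ℝ) + 1) * M.mu * unblocked v (n + 1)
        + ((n : ℝ) + 2) * M.mu * M.r * almostBlocked v (n + 2) := by
  have h1 := h.balance_succ n (Fin.last K)
  rw [sum_Q0_last, sum_Q1_last, sum_Q2_last] at h1
  have h2 := h.cut n
  have h3 := h.cut (n + 1)
  push_cast at h1 h2 h3
  linarith

/-- At a state without mass the outflow vanishes, so the balance equation is a vanishing sum of
nonnegative inflows. -/
theorem eq_zero_of_generator_pos (h : M.IsStationary v) {z y : QueueState K} (hy : v y = 0)
    (hzy : 0 < M.generator z y) : v z = 0 := by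
  by_cases e : z = y
  · rw [e, hy]
  have hs := h.balance y (Finset.univ ×ˢ Finset.range (y.2 + z.2 + 2)) fun w hw =>
    M.generator_eq_zero (Or.inl (by simp at hw; omega))
  rw [Finset.sum_eq_zero_iff_of_nonneg] at hs
  · exact (mul_eq_zero.1 (hs z (by simp; omega))).resolve_right hzy.ne'
  · intro w _
    by_cases e' : w = y
    · rw [e', hy, zero_mul]
    · exact mul_nonneg (h.nonneg w) (M.generator_nonneg e')

/-- A single zero would spread to all full states, down by orbit arrivals (rate λp) and up by orbit
losses (rate (m+1)μδ), then to every state by primary arrivals, contradicting total mass 1. -/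
theorem full_pos (h : M.IsStationary v) (hδ : 0 < M.delta) (hp : 0 < M.p) (h1 : HasSum v 1)
    (n : ℕ) : 0 < v (Fin.last K, n) := by
  have hlam := M.lam_pos
  have hmu := M.mu_pos
  refine (h.nonneg _).lt_of_ne' fun hn => ?_
  have down : ∀ m, v (Fin.last K, m + 1) = 0 → v (Fin.last K, m) = 0 := fun m hm =>
    h.eq_zero_of_generator_pos hm (by simp [generator, Q0]; positivity)
  have up : ∀ m, v (Fin.last K, m) = 0 → v (Fin.last K, m + 1) = 0 := fun m hm =>
    h.eq_zero_of_generator_pos hm (by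
      have : 0 < ((m : ℝ) + 1) * M.mu * M.delta := by positivity
      have hm' : m ≠ m + 1 + 1 := by omega
      simpa [generator, Q2, hm'] using this)
  have h0 : v (Fin.last K, 0) = 0 := by
    induction n with
    | zero => exact hn
    | succ n ih => exact ih (down n hn)
  have hfull : ∀ m, v (Fin.last K, m) = 0 := by
    intro m
    induction m with
    | zero => exact h0
    | succ m ih => exact up m ih
  have hall : ∀ (i : Fin (K + 1)) (m : ℕ), v (i, m) = 0 := by
    intro i m
    induction i using Fin.reverseInduction with
    | last => exact hfull m
    | cast i ih =>
      refine h.eq_zero_of_generator_pos ih ?_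
      simp [generator, Q1, Fin.castSucc_lt_succ.ne, hlam]
  have hz : v = 0 := funext fun x => hall x.1 x.2
  rw [hz] at h1
  exact zero_ne_one (hasSum_zero.unique h1)

theorem unblocked_nonneg (h : M.IsStationary v) (n : ℕ) : 0 ≤ unblocked v n :=
  Finset.sum_nonneg fun _ _ => h.nonneg _

/-- In `full_balance` the `almostBlocked` terms are dropped as nonnegative, and the next cut bounds
the remaining unblocked flow by λp times the full-state mass. -/
theorem unblocked_le (h : M.IsStationary v) (hδ : 0 < M.delta) (n : ℕ) :
    ((n : ℝ) + 1) * M.mu * unblocked v (n + 1)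
      ≤ (M.nu (Fin.last K) + M.lam * M.p) * v (Fin.last K, n + 1) := by
  have hmu := M.mu_pos
  have h1 := h.full_balance n
  have h2 := h.cut (n + 1)
  have h3 := mul_nonneg M.lam_pos.le (almostBlocked_nonneg h.nonneg (n + 1))
  have h4 : 0 ≤ ((n : ℝ) + 2) * M.mu * M.r * almostBlocked v (n + 2) :=
    mul_nonneg (mul_nonneg (by positivity) M.r_nonneg) (almostBlocked_nonneg h.nonneg _)
  have h5 : 0 ≤ ((n : ℝ) + 2) * M.mu * (M.delta * v (Fin.last K, n + 2)) :=
    mul_nonneg (by positivity) (mul_nonneg hδ.le (h.nonneg _))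
  push_cast at h2
  linarith

/-- On level `n + 1` the unblocked states carry the fraction `ν_K / ((n + 1) μ)` of the mass of the
full state, up to an error of second order. -/
theorem exists_unblocked_bound (h : M.IsStationary v) (hδ : 0 < M.delta) :
    ∃ A : ℝ, ∀ n : ℕ, |((n : ℝ) + 1) * M.mu * unblocked v (n + 1)
      - M.nu (Fin.last K) * v (Fin.last K, n + 1)| ≤ A / ((n : ℝ) + 1) * v (Fin.last K, n + 1) := by
  have hmu := M.mu_pos
  have hlam := M.lam_pos
  have hp := M.p_nonneg
  have hnu := M.nu_nonneg (Fin.last K)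
  set E := M.nu (Fin.last K) + M.lam * M.p with hE
  have hE0 : 0 ≤ E := by positivity
  -- The first summand bounds the primary arrivals into the full state (lower estimate), the second
  -- the retrial flow from level n+2 (upper estimate). The `almostBlocked` retrial term is
  -- nonnegative and at most that flow, so it adds no further error.
  refine ⟨M.lam * (E / M.mu) + E * (M.lam * M.p / (M.mu * M.delta)), fun n => ?_⟩
  have hx := h.nonneg (Fin.last K, n + 1)
  have h1 := h.full_balance n
  have hS := h.unblocked_le hδ n
  have hS' := h.unblocked_le hδ (n + 1)
  have hcut := h.cut (n + 1)
  have ha := almostBlocked_nonneg h.nonneg (n + 1)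
  have ha' := almostBlocked_le h.nonneg (n + 1)
  have hb := almostBlocked_nonneg h.nonneg (n + 2)
  have hb' := almostBlocked_le h.nonneg (n + 2)
  have hn : (0 : ℝ) < (n : ℝ) + 1 := by positivity
  push_cast at hS' hcut
  rw [← hE] at hS hS'
  have c1 : M.lam * unblocked v (n + 1)
      ≤ M.lam * (E / M.mu) / ((n : ℝ) + 1) * v (Fin.last K, n + 1) := by
    rw [mul_div_assoc, mul_assoc]
    refine mul_le_mul_of_nonneg_left ?_ hlam.le
    rw [div_div, div_mul_eq_mul_div, le_div_iff₀ (by positivity)]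
    linarith
  have c2 : v (Fin.last K, n + 2)
      ≤ M.lam * M.p / (M.mu * M.delta) / ((n : ℝ) + 1) * v (Fin.last K, n + 1) := by
    rw [div_div, div_mul_eq_mul_div, le_div_iff₀ (by positivity)]
    have t1 : 0 ≤ ((n : ℝ) + 1 + 1) * M.mu * unblocked v (n + 2) :=
      mul_nonneg (by positivity) (h.unblocked_nonneg _)
    have t2 : 0 ≤ M.mu * M.delta * v (Fin.last K, n + 2) :=
      mul_nonneg (by positivity) (h.nonneg _)
    linarith
  have c3 : ((n : ℝ) + 2) * M.mu * unblocked v (n + 2)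
      ≤ E * (M.lam * M.p / (M.mu * M.delta)) / ((n : ℝ) + 1) * v (Fin.last K, n + 1) := by
    have := mul_le_mul_of_nonneg_left c2 hE0
    rw [mul_div_assoc, mul_assoc]
    linarith
  have c4 : M.lam * almostBlocked v (n + 1) ≤ M.lam * unblocked v (n + 1) :=
    mul_le_mul_of_nonneg_left ha' hlam.le
  have c5 : ((n : ℝ) + 2) * M.mu * M.r * almostBlocked v (n + 2)
      ≤ ((n : ℝ) + 2) * M.mu * unblocked v (n + 2) := by
    rw [mul_assoc _ M.r]
    refine mul_le_mul_of_nonneg_left ?_ (by positivity)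
    exact (mul_le_of_le_one_left hb M.r_le_one).trans hb'
  have c6 : 0 ≤ ((n : ℝ) + 2) * M.mu * M.r * almostBlocked v (n + 2) :=
    mul_nonneg (mul_nonneg (by positivity) M.r_nonneg) hb
  have c7 := mul_nonneg hlam.le ha
  have c8 : 0 ≤ ((n : ℝ) + 2) * M.mu * unblocked v (n + 2) := by linarith
  have c9 := mul_nonneg hlam.le (h.unblocked_nonneg (n + 1))
  rw [add_div, add_mul, abs_le]
  constructor <;> linarith

theorem full_bounds (h : M.IsStationary v) (hδ : 0 < M.delta) (h1 : HasSum v 1) :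
    ∃ C₁ C₂ : ℝ, 0 < C₁ ∧ 0 < C₂ ∧ ∀ n : ℕ, 1 ≤ n →
      C₁ * (M.gamma ^ n * (n : ℝ) ^ (-(M.nu (Fin.last K) / (M.mu * M.delta))) / (n.factorial : ℝ))
          ≤ v (Fin.last K, n) ∧
      v (Fin.last K, n) ≤
        C₂ * (M.gamma ^ n * (n : ℝ) ^ (-(M.nu (Fin.last K) / (M.mu * M.delta)))
          / (n.factorial : ℝ)) := by
  have hmu := M.mu_pos
  have hlam := M.lam_pos
  have hnu := M.nu_nonneg (Fin.last K)
  rcases M.p_nonneg.eq_or_lt with hp | hp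
  -- If p = 0 then γ = 0 and the cut kills the full states on levels n ≥ 1, so both sides vanish.
  · refine ⟨1, 1, one_pos, one_pos, fun n hn => ?_⟩
    obtain ⟨n, rfl⟩ : ∃ m, n = m + 1 := ⟨n - 1, by omega⟩
    have hc := h.cut n
    have hS := h.unblocked_nonneg (n + 1)
    have hx := mul_nonneg hδ.le (h.nonneg (Fin.last K, n + 1))
    rw [← hp, mul_zero, zero_mul, eq_comm, mul_eq_zero] at hc
    have hc' := hc.resolve_left (by positivity)
    have hx0 : v (Fin.last K, n + 1) = 0 :=
      (mul_eq_zero.1 (by linarith : M.delta * v (Fin.last K, n + 1) = 0)).resolve_left hδ.ne'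
    simp [gamma, ← hp, hx0]
  have hpos := h.full_pos hδ hp h1
  have hγ : 0 < M.gamma := by rw [gamma]; positivity
  obtain ⟨A, hA⟩ := h.exists_unblocked_bound hδ
  -- Scaling by n!/γⁿ absorbs the factor λp/((n+1)μδ) of the cut, leaving only 1 + u.
  obtain ⟨C₁, C₂, hC₁, hC₂, hC⟩ := exists_rpow_bounds_of_ratio
    (y := fun n => v (Fin.last K, n) * n.factorial / M.gamma ^ n)
    (u := fun n => unblocked v n / (M.delta * v (Fin.last K, n)))
    (κ := M.nu (Fin.last K) / (M.mu * M.delta)) (B := A / (M.mu * M.delta))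
    (by positivity) (fun n => by have := hpos n; positivity)
    (fun n _ => div_nonneg (h.unblocked_nonneg n) (mul_nonneg hδ.le (h.nonneg _)))
    (fun n hn => by
      obtain ⟨n, rfl⟩ : ∃ m, n = m + 1 := ⟨n - 1, by omega⟩
      have hx := hpos (n + 1)
      have hn : (0 : ℝ) < (n : ℝ) + 1 := by positivity
      push_cast
      have e : unblocked v (n + 1) / (M.delta * v (Fin.last K, n + 1))
          - M.nu (Fin.last K) / (M.mu * M.delta) / ((n : ℝ) + 1)
          = (((n : ℝ) + 1) * M.mu * unblocked v (n + 1)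
            - M.nu (Fin.last K) * v (Fin.last K, n + 1))
            / (((n : ℝ) + 1) * M.mu * M.delta * v (Fin.last K, n + 1)) := by
        field_simp
      rw [e, abs_div, abs_of_pos (by positivity : (0 : ℝ) < ((n : ℝ) + 1) * M.mu * M.delta *
        v (Fin.last K, n + 1)), div_le_iff₀ (by positivity)]
      refine (hA n).trans_eq ?_
      field_simp)
    (fun n => by
      have hx := hpos (n + 1)
      have hn : (0 : ℝ) < (n : ℝ) + 1 := by positivity
      have hc := h.cut n
      have hc' : v (Fin.last K, n) = ((n : ℝ) + 1) * M.mu *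
        (unblocked v (n + 1) + M.delta * v (Fin.last K, n + 1)) / (M.lam * M.p) := by
        rw [eq_div_iff (by positivity)]; linarith
      rw [hc', Nat.factorial_succ, pow_succ, gamma]
      push_cast
      field_simp
      ring)
  refine ⟨C₁, C₂, hC₁, hC₂, fun n hn => ?_⟩
  obtain ⟨ha, hb⟩ := hC n hn
  have hf : (0 : ℝ) < n.factorial := by exact_mod_cast n.factorial_pos
  have hg := pow_pos hγ n
  rw [le_div_iff₀ hg] at ha
  rw [div_le_iff₀ hg] at hb
  rw [← mul_div_assoc, ← mul_div_assoc, div_le_iff₀ hf, le_div_iff₀ hf]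
  constructor <;> linarith

end IsStationary
end RetrialQueue

theorem mainTheorem3 {K : ℕ} (M : RetrialQueue K) (hM : 0 < M.delta)
    {Ω : Type*} [MeasurableSpace Ω] (μ : Measure Ω) [IsProbabilityMeasure μ]
    (X : ℝ → Ω → QueueState K) (hX : IsMarkovChain M.generator μ X)
    (π : QueueState K → ℝ) (hπ : IsLimitingDistribution μ X π) :
    ∃ C₁ C₂ : ℝ, 0 < C₁ ∧ 0 < C₂ ∧ ∀ n : ℕ, 1 ≤ n →
      C₁ * (M.gamma ^ n * (n : ℝ) ^ (-(M.nu (Fin.last K) / (M.mu * M.delta))) / (n.factorial : ℝ))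
          ≤ π (Fin.last K, n) ∧
      π (Fin.last K, n) ≤
        C₂ * (M.gamma ^ n * (n : ℝ) ^ (-(M.nu (Fin.last K) / (M.mu * M.delta)))
          / (n.factorial : ℝ)) := by
  have h : M.IsStationary π :=
    { nonneg := fun x => ge_of_tendsto' (hπ.1 x) fun _ => measureReal_nonneg
      balance := fun _ _ hs => hX.balance hπ hs }
  exact h.full_bounds hM hπ.2
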